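/- **Proposition 4.** Let $n=n_1+\cdots+n_k$ with all $n_i\ge 1$, let $\mathcal K=\mathcal K^1\times\cdots\times\mathcal K^k\subset\mathbf R^n$ with $\mathcal K^i=\{v\in\mathbf R^{n_i}: v_1\ge\|v_{2:n_i}\|\}$ (a half-line if $n_i=1$), and let $A\in\mathbf R^{p\times n}$ with $\operatorname{rank}A=p$, $b\in\mathbf R^p$, $c\in\mathbf R^n$. All norms are Euclidean. For $v\in\mathbf R^n$ with subvectors $v^{(i)}\in\mathbf R^{n_i}$ let $\operatorname{mat}(v)$ be the block diagonal matrix with the blocks $\begin{pmatrix}v^{(i)}_1&(v^{(i)}_{2:n_i})^T\\ v^{(i)}_{2:n_i}&v^{(i)}_1I\end{pmatrix}$, let $T_v$ be the block diagonal matrix with the blocks $\begin{pmatrix}u_1&u_{2:n_i}^T\\u_{2:n_i}&\beta_uI+\frac{u_{2:n_i}u_{2:n_i}^T}{\beta_u+u_1}\end{pmatrix}$, where $u=v^{(i)}$ and $\beta_u=\sqrt{u_1^2-\|u_{2:n_i}\|^2}$, and let $e$ be the vector all of whose subvectors are $e^{(i)}=(1,0,\dots,0)^T$. For $z=(x,y,s,\kappa,\tau)$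 in the interior of $\mathcal C=\mathcal K\times\mathbf R^p\times\mathcal K\times\mathbf R_+\times\mathbf R_+$ put $$\mu(z)=\frac{x^Ts+\kappa\tau}{k+1},\qquad d_2(z)=\sqrt2\,\bigl\|(T_xs,\kappa\tau)-\mu(z)(e,1)\bigr\|,$$ $$\mathcal N_2(\gamma)=\{z\in\operatorname{int}\mathcal C: d_2(z)\le\gamma\mu(z)\},\qquad r_p(z)=Ax-\tau b,\qquad r_d(z)=A^Ty+s-\tau c.$$ Let $\gamma\in(0,1/3)$ and $\delta\in(0,1)$ satisfy $$\frac{4(\gamma^2+\delta^2)}{(1-3\gamma)^2}\Bigl(1-\frac{\delta}{\sqrt{2(k+1)}}\Bigr)^{-1}<\gamma ,$$ put $\nu=1-\delta/\sqrt{2(k+1)}$, and let $\epsilon\in(0,1)$ and $z_0\in\mathcal N_2(\gamma)$. The infeasible interior point method with unscaled directions ($D=I$) starts at $z=z_0$ and, as long as the stop criterion "$\|r_p(z)\|\le\epsilon\|r_p(z_0)\|$, $\|r_d(z)\|\le\epsilon\|r_d(z_0)\|$ and $\mu(z)\le\epsilon\mu(z_0)$" fails, replaces $z=(x,y,s,\kappa,\tau)$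 by $z+(\Delta x,\Delta y,\Delta s,\Delta\kappa,\Delta\tau)$, where $$\begin{aligned} A\Delta x-b\Delta\tau&=-(1-\nu)(Ax-b\tau),\\ -A^T\Delta y+c\Delta\tau-\Delta s&=-(1-\nu)(-A^Ty+c\tau-s),\\ b^T\Delta y-c^T\Delta x-\Delta\kappa&=-(1-\nu)(b^Ty-c^Tx-\kappa),\\ \operatorname{mat}(x)\Delta s+\operatorname{mat}(s)\Delta x&=\nu\mu(z) e-\operatorname{mat}(x)\operatorname{mat}(s)e,\\ \kappa\Delta\tau+\tau\Delta\kappa&=\nu\mu(z)-\kappa\tau . \end{aligned}$$ Then for every $j\ge0$, if $z$ is the point of the method after $j$ iterations, the linear system above has exactly one solution at $z$ (so the method is well defined), and $$z\in\mathcal N_2(\gamma),\quad \|r_p(z)\|=\nu^j\|r_p(z_0)\|,\quad \|r_d(z)\|=\nu^j\|r_d(z_0)\|,\quad \mu(z)=\nu^j\mu(z_0).$$ -/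

import Mathlib

namespace SOCP

open Matrix

/-- Coordinates of `ℝⁿ = ℝ^{n₁} × ⋯ × ℝ^{n_k}` with `nᵢ = d i + 1 ≥ 1`: the pair `⟨i, a⟩` is the
`a`-th coordinate (counted from `0`) in the `i`-th cone. The case `d i = 0` is a one-dimensional
linear cone. -/
abbrev Idx {k : ℕ} (d : Fin k → ℕ) : Type := (i : Fin k) × Fin (d i + 1)

/-- The space `ℝⁿ` of the primal variable. -/
abbrev Vec {k : ℕ} (d : Fin k → ℕ) : Type := Idx d → ℝ

/-- The Euclidean norm. -/
noncomputable def norm2 {ι : Type} [Fintype ι] (v : ι → ℝ) : ℝ := ‖WithLp.toLp 2 v‖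

/-- The subvector `v⁽ⁱ⁾`. -/
def block {k : ℕ} {d : Fin k → ℕ} (v : Vec d) (i : Fin k) : Fin (d i + 1) → ℝ :=
  fun a => v ⟨i, a⟩

/-- The second-order cone in `ℝ^{m+1}`; for `m = 0` it is the half-line `[0, ∞)`. -/
def socone (m : ℕ) : Set (Fin (m + 1) → ℝ) := {u | norm2 (Fin.tail u) ≤ u 0}

/-- The product cone `𝒦 = 𝒦¹ × ⋯ × 𝒦ᵏ`. -/
def cone {k : ℕ} (d : Fin k → ℕ) : Set (Vec d) := {v | ∀ i, block v i ∈ socone (d i)}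

/-- The unit element `e` of the Jordan algebra. -/
def unit {k : ℕ} (d : Fin k → ℕ) : Vec d := fun q => if q.2 = 0 then 1 else 0

/-- The arrow head matrix of one block. -/
def arrow {m : ℕ} (u : Fin (m + 1) → ℝ) : Matrix (Fin (m + 1)) (Fin (m + 1)) ℝ :=
  Matrix.of fun a b =>
    if a = 0 then u b else if b = 0 then u a else if a = b then u 0 else 0

/-- The block diagonal arrow head matrix `mat(v)`. -/
def mat {k : ℕ} {d : Fin k → ℕ} (v : Vec d) : Matrix (Idx d) (Idx d) ℝ :=
  Matrix.blockDiagonal' fun i => arrow (block v i)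

/-- `β_u = √(u₁² - ‖u_{2:n}‖²)`. -/
noncomputable def beta {m : ℕ} (u : Fin (m + 1) → ℝ) : ℝ :=
  Real.sqrt (u 0 ^ 2 - norm2 (Fin.tail u) ^ 2)

/-- The matrix `T_u` of one block. -/
noncomputable def Tblock {m : ℕ} (u : Fin (m + 1) → ℝ) :
    Matrix (Fin (m + 1)) (Fin (m + 1)) ℝ :=
  Matrix.of fun a b =>
    if a = 0 then u b else if b = 0 then u a
    else (if a = b then beta u else 0) + u a * u b / (beta u + u 0)

/-- The block diagonal scaling matrix `T_v`. -/
noncomputable def T {k : ℕ} {d : Fin k → ℕ} (v : Vec d) : Matrix (Idx d) (Idx d) ℝ :=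
  Matrix.blockDiagonal' fun i => Tblock (block v i)

/-- Points `(x, y, s, κ, τ)`. -/
abbrev Point (p : ℕ) {k : ℕ} (d : Fin k → ℕ) : Type :=
  Vec d × (Fin p → ℝ) × Vec d × ℝ × ℝ

namespace Point

abbrev x {p k : ℕ} {d : Fin k → ℕ} (z : Point p d) : Vec d := z.1
abbrev y {p k : ℕ} {d : Fin k → ℕ} (z : Point p d) : Fin p → ℝ := z.2.1
abbrev s {p k : ℕ} {d : Fin k → ℕ} (z : Point p d) : Vec d := z.2.2.1
abbrev κ {p k : ℕ} {d : Fin k → ℕ} (z : Point p d) : ℝ := z.2.2.2.1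
abbrev τ {p k : ℕ} {d : Fin k → ℕ} (z : Point p d) : ℝ := z.2.2.2.2

end Point

/-- The cone `𝒞 = 𝒦 × ℝᵖ × 𝒦 × ℝ₊ × ℝ₊`. -/
def bigCone (p : ℕ) {k : ℕ} (d : Fin k → ℕ) : Set (Point p d) :=
  {z | z.x ∈ cone d ∧ z.s ∈ cone d ∧ 0 ≤ z.κ ∧ 0 ≤ z.τ}

/-- The central path coefficient `μ = (xᵀs + κτ) / (k + 1)`. -/
noncomputable def mu {p k : ℕ} {d : Fin k → ℕ} (z : Point p d) : ℝ :=
  (z.x ⬝ᵥ z.s + z.κ * z.τ) / ((k : ℝ) + 1)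

/-- The distance `d₂ = √2 ‖(T_x s, κτ) - μ (e, 1)‖` to the central path. -/
noncomputable def dist2 {p k : ℕ} {d : Fin k → ℕ} (z : Point p d) : ℝ :=
  Real.sqrt 2 *
    norm2 (Sum.elim (T z.x *ᵥ z.s) (fun _ : Unit => z.κ * z.τ)
      - mu z • Sum.elim (unit d) (fun _ : Unit => 1))

/-- The neighbourhood `𝒩₂(γ)` of the central path. -/
def N2 (p : ℕ) {k : ℕ} (d : Fin k → ℕ) (γ : ℝ) : Set (Point p d) :=
  {z | z ∈ interior (bigCone p d) ∧ dist2 z ≤ γ * mu z}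

/-- The data `A ∈ ℝ^{p×n}`, `b ∈ ℝᵖ`, `c ∈ ℝⁿ` of the program
`min cᵀx` subject to `Ax = b`, `x ∈ 𝒦`. -/
structure Problem (p : ℕ) {k : ℕ} (d : Fin k → ℕ) where
  A : Matrix (Fin p) (Idx d) ℝ
  b : Fin p → ℝ
  c : Vec d

/-- The primal residual `r_p = Ax - τb`. -/
def rp {p k : ℕ} {d : Fin k → ℕ} (P : Problem p d) (z : Point p d) : Fin p → ℝ :=
  P.A *ᵥ z.x - z.τ • P.b

/-- The dual residual `r_d = Aᵀy + s - τc`. -/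
def rd {p k : ℕ} {d : Fin k → ℕ} (P : Problem p d) (z : Point p d) : Vec d :=
  P.Aᵀ *ᵥ z.y + z.s - z.τ • P.c

/-- The reduction factor `ν = 1 - δ / √(2(k+1))`. -/
noncomputable def nu (k : ℕ) (δ : ℝ) : ℝ := 1 - δ / Real.sqrt (2 * ((k : ℝ) + 1))

/-- `Δ` solves the linear system for the search direction at the point `z`, with parameter `ν` and
scaling matrix `D`, where `x̄ = D⁻ᵀx` and `s̄ = Ds`. -/
def IsDirection {p k : ℕ} {d : Fin k → ℕ} (P : Problem p d) (ν : ℝ)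
    (D : Matrix (Idx d) (Idx d) ℝ) (z Δ : Point p d) : Prop :=
  P.A *ᵥ Δ.x - Δ.τ • P.b = -((1 - ν) • (P.A *ᵥ z.x - z.τ • P.b)) ∧
  -(P.Aᵀ *ᵥ Δ.y) + Δ.τ • P.c - Δ.s
    = -((1 - ν) • (-(P.Aᵀ *ᵥ z.y) + z.τ • P.c - z.s)) ∧
  P.b ⬝ᵥ Δ.y - P.c ⬝ᵥ Δ.x - Δ.κ = -((1 - ν) * (P.b ⬝ᵥ z.y - P.c ⬝ᵥ z.x - z.κ)) ∧
  mat ((D⁻¹)ᵀ *ᵥ z.x) *ᵥ (D *ᵥ Δ.s) + mat (D *ᵥ z.s) *ᵥ ((D⁻¹)ᵀ *ᵥ Δ.x)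
    = (ν * mu z) • unit d - mat ((D⁻¹)ᵀ *ᵥ z.x) *ᵥ (mat (D *ᵥ z.s) *ᵥ unit d) ∧
  z.κ * Δ.τ + z.τ * Δ.κ = ν * mu z - z.κ * z.τ

/-- The stop criterion with threshold `ε`, relative to the initial point `z₀`. -/
def Stop {p k : ℕ} {d : Fin k → ℕ} (P : Problem p d) (ε : ℝ) (z₀ z : Point p d) : Prop :=
  norm2 (rp P z) ≤ ε * norm2 (rp P z₀) ∧
  norm2 (rd P z) ≤ ε * norm2 (rd P z₀) ∧
  mu z ≤ ε * mu z₀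

/-- `Reaches P δ ε D z₀ j z`: the infeasible interior point method with scaling matrix `D`, started
at `z₀`, has the current point `z` after `j` iterations of its loop. -/
inductive Reaches {p k : ℕ} {d : Fin k → ℕ} (P : Problem p d) (δ ε : ℝ)
    (D : Matrix (Idx d) (Idx d) ℝ) (z₀ : Point p d) : ℕ → Point p d → Prop
  | init : Reaches P δ ε D z₀ 0 z₀
  | step {j : ℕ} {z Δ : Point p d} (hz : Reaches P δ ε D z₀ j z) (hcont : ¬ Stop P ε z₀ z)
      (hΔ : IsDirection P (nu k δ) D z Δ) : Reaches P δ ε D z₀ (j + 1) (z + Δ)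

end SOCP

/-! The cone is the cone of squares of a product of spin factors, and (τ, κ) is one more,
one-dimensional, factor; so z becomes a pair (x, s) with Jordan product `jmul`, and `scale x` is
T_x, symmetric and with det (T_x q) = det x · det q.

Write Δx = T_x q, t = T_x Δs, p = T_x s - μe and θ = νμ. In these coordinates the linearized
complementarity equation reads t + μq = g - p∘q - `wedge x p q` with g = (θ - μ)e - p
(`scale_add_smul_eq`); the wedge is the price of the unscaled direction. The linear rows force ⟨q,
t⟩ = ⟨Δx, Δs⟩ = 0, so the left side has squared norm μ²‖q‖² + ‖t‖², while the bilinear errors are at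
most 3γμ‖q‖. Hence (1 - 3γ)²(μ²‖q‖² + ‖t‖²) ≤ ‖g‖² (`sq_add_sq_le`). With zero right-hand sides this
gives injectivity of the square system, hence a unique direction.

For the new distance, ‖T_x b - θe‖ depends on (x, b) only through ⟨x, b⟩ and det x · det b. So (x +
Δx, s + Δs) may be replaced by (e + q, T_x(s + Δs)), and the distance is at most that of the Jordan
product of this pair from θe. There all first-order terms cancel and q∘t - `wedge x p q` remains
(`norm_scale_scale_sub_sq_le_of_eq`), which the parameter condition controls. Finally ⟨Δx, Δs⟩ = 0
makes μ, like the residuals, shrink exactly by ν. -/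

open scoped RealInnerProductSpace

/-! ### Algebra of one spin factor -/

/-- The spin factor `ℝ × E`. -/
abbrev Spin (E : Type*) : Type _ := WithLp 2 (ℝ × E)

namespace Spin

variable {E : Type*}

/-- The element `(a, v)`. -/
def mk (a : ℝ) (v : E) : Spin E := WithLp.toLp 2 (a, v)

@[simp] lemma mk_fst (a : ℝ) (v : E) : (mk a v).fst = a := rfl

@[simp] lemma mk_snd (a : ℝ) (v : E) : (mk a v).snd = v := rfl

lemma ext' {x y : Spin E} (h₁ : x.fst = y.fst) (h₂ : x.snd = y.snd) : x = y :=
  WithLp.ofLp_injective 2 (Prod.ext h₁ h₂)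

variable [NormedAddCommGroup E]

lemma norm_sq_eq (x : Spin E) : ‖x‖ ^ 2 = x.fst ^ 2 + ‖x.snd‖ ^ 2 := by
  rw [WithLp.prod_norm_sq_eq_of_L2]
  simp

/-- The unit element. -/
def one : Spin E := mk 1 0

/-- The determinant, i.e. the product of the two spectral values. -/
noncomputable def det (x : Spin E) : ℝ := x.fst ^ 2 - ‖x.snd‖ ^ 2

/-- Membership in the interior of the second-order cone. -/
def Pos (x : Spin E) : Prop := ‖x.snd‖ < x.fst

lemma Pos.fst_pos {x : Spin E} (hx : Pos x) : 0 < x.fst := (norm_nonneg _).trans_lt hx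

lemma Pos.det_pos {x : Spin E} (hx : Pos x) : 0 < det x := by
  have h : ‖x.snd‖ < x.fst := hx
  unfold det
  nlinarith [norm_nonneg x.snd]

lemma pos_of_det_pos {x : Spin E} (h : 0 < det x) (h0 : 0 < x.fst) : Pos x := by
  unfold det at h
  exact lt_of_pow_lt_pow_left₀ 2 h0.le (by linarith)

lemma Pos.norm_snd_sq {x : Spin E} (hx : Pos x) : ‖x.snd‖ ^ 2 = x.fst ^ 2 - √(det x) ^ 2 := by
  rw [Real.sq_sqrt hx.det_pos.le, det]
  ring

variable [InnerProductSpace ℝ E]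

/-- The spectral values of q are q.fst ± ‖q.snd‖, of absolute value at most √2‖q‖ < c. -/
lemma pos_one_add {q : Spin E} {c : ℝ} (hc : 0 < c) (hq : 2 * ‖q‖ ^ 2 < c ^ 2) :
    Pos (c • one + q) := by
  have h := norm_sq_eq q
  have h2 : ‖q.snd‖ < c + q.fst := by
    have h3 : (‖q.snd‖ + |q.fst|) ^ 2 < c ^ 2 := by
      nlinarith [sq_abs q.fst, sq_nonneg (‖q.snd‖ - |q.fst|)]
    have h4 := lt_of_pow_lt_pow_left₀ 2 hc.le h3
    linarith [neg_abs_le q.fst]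
  simpa [Pos, one] using h2

lemma inner_eq (x y : Spin E) : ⟪x, y⟫ = x.fst * y.fst + ⟪x.snd, y.snd⟫ := by
  rw [WithLp.prod_inner_apply]
  simp [mul_comm]

/-- The Jordan product. -/
def jmul (x y : Spin E) : Spin E :=
  mk (x.fst * y.fst + ⟪x.snd, y.snd⟫) (x.fst • y.snd + y.fst • x.snd)

/-- The quadratic representation of the square root of `x`. -/
noncomputable def scale (x q : Spin E) : Spin E :=
  mk (x.fst * q.fst + ⟪x.snd, q.snd⟫)
    (q.fst • x.snd + √(det x) • q.snd + (⟪x.snd, q.snd⟫ / (√(det x) + x.fst)) • x.snd)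

/-- The antisymmetric part of the scaled linearization of the Jordan product at `x`. -/
noncomputable def wedge (x p q : Spin E) : Spin E :=
  mk 0 ((⟪x.snd, q.snd⟫ / x.fst) • p.snd - (⟪x.snd, p.snd⟫ / x.fst) • q.snd)

lemma Pos.inner_pos {x y : Spin E} (hx : Pos x) (hy : Pos y) : 0 < ⟪x, y⟫ := by
  rw [inner_eq]
  have hx' : ‖x.snd‖ < x.fst := hx
  have hy' : ‖y.snd‖ < y.fst := hy
  have h := (abs_le.1 (abs_real_inner_le_norm x.snd y.snd)).1
  nlinarith [norm_nonneg x.snd, norm_nonneg y.snd]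

/-- An element of nonzero determinant in one of the two open half cones is in the positive one if
its product with a positive element is positive. -/
lemma pos_of_inner_pos {x y : Spin E} (hx : Pos x) (hy : 0 < det y) (h : 0 < ⟪x, y⟫) :
    Pos y := by
  refine pos_of_det_pos hy ?_
  by_contra! h0
  have hny : ‖y.snd‖ < -y.fst := by
    unfold det at hy
    exact lt_of_pow_lt_pow_left₀ 2 (by linarith) (by linarith [neg_sq y.fst])
  have h1 := hx.inner_pos (y := -y) (by simpa [Pos] using hny)
  rw [inner_neg_right] at h1
  linarith

/-- The right side minus the left is (p₀q₀ - ⟨p̄, q̄⟩)² + ‖p₀q̄ - q₀p̄‖² plus twice the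
Cauchy–Schwarz deficit of p̄ and q̄. -/
lemma norm_jmul_sq_le (p q : Spin E) : ‖jmul p q‖ ^ 2 ≤ 2 * ‖p‖ ^ 2 * ‖q‖ ^ 2 := by
  rw [norm_sq_eq, norm_sq_eq p, norm_sq_eq q]
  simp only [jmul, mk_fst, mk_snd]
  rw [norm_add_sq_real, norm_smul, norm_smul, inner_smul_left, inner_smul_right, mul_pow, mul_pow,
    Real.norm_eq_abs, Real.norm_eq_abs, sq_abs, sq_abs, real_inner_comm q.snd p.snd]
  have h1 : ⟪q.snd, p.snd⟫ ^ 2 ≤ ‖q.snd‖ ^ 2 * ‖p.snd‖ ^ 2 := by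
    rw [← mul_pow, sq_le_sq, abs_of_nonneg (by positivity : 0 ≤ ‖q.snd‖ * ‖p.snd‖)]
    exact abs_real_inner_le_norm _ _
  have h2 : 0 ≤ ‖p.fst • q.snd - q.fst • p.snd‖ ^ 2 := sq_nonneg _
  rw [norm_sub_sq_real, norm_smul, norm_smul, inner_smul_left, inner_smul_right, mul_pow, mul_pow,
    Real.norm_eq_abs, Real.norm_eq_abs, sq_abs, sq_abs] at h2
  simp only [conj_trivial] at h2 ⊢
  nlinarith [sq_nonneg (p.fst * q.fst - ⟪q.snd, p.snd⟫)]

/-- Positivity of x gives ‖x.snd‖ ≤ x.fst, so the division by x.fst costs nothing and the bound is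
uniform in x. -/
lemma norm_wedge_le {x : Spin E} (hx : Pos x) (p q : Spin E) :
    ‖wedge x p q‖ ≤ 2 * ‖p‖ * ‖q‖ := by
  have h0 := hx.fst_pos
  have key (u v : E) : ‖(⟪x.snd, u⟫ / x.fst) • v‖ ≤ ‖u‖ * ‖v‖ := by
    rw [norm_smul, Real.norm_eq_abs, abs_div, abs_of_pos h0]
    gcongr
    rw [div_le_iff₀ h0]
    have h1 := abs_real_inner_le_norm x.snd u
    have h2 : ‖x.snd‖ * ‖u‖ ≤ x.fst * ‖u‖ := by
      gcongr
      exact hx.le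
    linarith
  have h1 : ‖wedge x p q‖ = ‖(wedge x p q).snd‖ := by
    have := norm_sq_eq (wedge x p q)
    rw [show (wedge x p q).fst = 0 from rfl] at this
    exact (pow_left_inj₀ (norm_nonneg _) (norm_nonneg _) two_ne_zero).1 (by linarith)
  rw [h1]
  have h2 := (norm_sub_le ((⟪x.snd, q.snd⟫ / x.fst) • p.snd)
    ((⟪x.snd, p.snd⟫ / x.fst) • q.snd)).trans (add_le_add (key _ _) (key _ _))
  have h3 : ‖p.snd‖ * ‖q.snd‖ ≤ ‖p‖ * ‖q‖ := by
    gcongr <;> exact WithLp.norm_snd_le _ _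
  calc _ ≤ _ := h2
    _ ≤ 2 * ‖p‖ * ‖q‖ := by linarith

lemma inner_scale_left (x p q : Spin E) : ⟪scale x p, q⟫ = ⟪p, scale x q⟫ := by
  simp only [inner_eq, scale, mk_fst, mk_snd, inner_add_left, inner_add_right, inner_smul_left,
    inner_smul_right, conj_trivial, real_inner_comm x.snd p.snd]
  ring

lemma det_scale {x : Spin E} (hx : Pos x) (q : Spin E) : det (scale x q) = det x * det q := by
  have hN := hx.norm_snd_sq
  have hb : √(det x) + x.fst ≠ 0 := (add_pos_of_nonneg_of_pos (Real.sqrt_nonneg _) hx.fst_pos).ne'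
  suffices h : det (scale x q) = √(det x) ^ 2 * det q by rw [h, Real.sq_sqrt hx.det_pos.le]
  rw [det, det.eq_1 q, scale, mk_fst, mk_snd]
  generalize √(det x) = β at *
  have e : ∀ a b : ℝ, ‖q.fst • x.snd + a • q.snd + b • x.snd‖ ^ 2
      = (q.fst + b) ^ 2 * ‖x.snd‖ ^ 2 + 2 * (q.fst + b) * a * ⟪x.snd, q.snd⟫
        + a ^ 2 * ‖q.snd‖ ^ 2 := by
    intro a b
    rw [show q.fst • x.snd + a • q.snd + b • x.snd = (q.fst + b) • x.snd + a • q.snd by module,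
      norm_add_sq_real, norm_smul, norm_smul, inner_smul_left, inner_smul_right, mul_pow, mul_pow,
      Real.norm_eq_abs, Real.norm_eq_abs, sq_abs, sq_abs]
    simp only [conj_trivial]
    ring
  rw [e, hN]
  field_simp
  ring

lemma exists_scale_eq {x : Spin E} (hx : Pos x) (u : Spin E) : ∃ q, scale x q = u := by
  have hN := hx.norm_snd_sq
  have hβ : 0 < √(det x) := Real.sqrt_pos.2 hx.det_pos
  have h0 := hx.fst_pos
  have e (a b c : ℝ) : ⟪x.snd, a • (b • x.snd + c • u.snd)⟫
      = a * (b * ‖x.snd‖ ^ 2 + c * ⟪x.snd, u.snd⟫) := by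
    rw [inner_smul_right, inner_add_right, inner_smul_right, inner_smul_right,
      real_inner_self_eq_norm_sq]
  -- The witness is T_{x⁻¹} u, where x⁻¹ = (x.fst, -x.snd) / det x.
  refine ⟨mk ((x.fst * u.fst - ⟪x.snd, u.snd⟫) / √(det x) ^ 2) ((1 / √(det x) ^ 2) •
    ((⟪x.snd, u.snd⟫ / (√(det x) + x.fst) - u.fst) • x.snd + √(det x) • u.snd)), ?_⟩
  apply ext'
  · simp only [scale, mk_fst, mk_snd, e, hN]
    field_simp
    ring
  · simp only [scale, mk_fst, mk_snd, e, hN]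
    generalize √(det x) = β at *
    match_scalars
    · field_simp
      ring
    · field_simp

lemma scale_fst (x q : Spin E) : (scale x q).fst = ⟪x, q⟫ := (inner_eq x q).symm

lemma scale_one (x : Spin E) : scale x one = x := by
  apply ext' <;> simp [scale, one]

lemma scale_zero (x : Spin E) : scale x 0 = 0 := by
  apply ext' <;> simp [scale]

lemma scale_add (x p q : Spin E) : scale x (p + q) = scale x p + scale x q := by
  apply ext'
  · simp [scale, inner_add_right]
    ring
  · simp only [scale, WithLp.add_fst, WithLp.add_snd, mk_snd, inner_add_right, add_div]
    module

lemma jmul_add_right (x p q : Spin E) : jmul x (p + q) = jmul x p + jmul x q := by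
  apply ext'
  · simp [jmul, inner_add_right]
    ring
  · simp only [jmul, WithLp.add_fst, WithLp.add_snd, mk_snd]
    module

lemma jmul_comm (x y : Spin E) : jmul x y = jmul y x := by
  apply ext'
  · simp [jmul, real_inner_comm, mul_comm]
  · simp [jmul, add_comm]

/-- The linearized complementarity equation in scaled coordinates. -/
lemma scale_add_jmul_eq {x : Spin E} (hx : Pos x) {s b q : Spin E} {θ : ℝ}
    (h : jmul x b + jmul s (scale x q) = θ • one) :
    scale x b + jmul (scale x s) q + wedge x (scale x s) q = θ • one := by
  have h1 := congrArg WithLp.fst h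
  have h2 := congrArg WithLp.snd h
  have hsym := inner_scale_left x s q
  have hN := hx.norm_snd_sq
  have hβ : 0 < √(det x) := Real.sqrt_pos.2 hx.det_pos
  have h0 := hx.fst_pos
  rw [inner_eq, inner_eq s] at hsym
  apply ext'
  · simp only [WithLp.add_fst, jmul, mk_fst, wedge, scale_fst, inner_eq] at h1 hsym ⊢
    linarith
  · simp only [WithLp.add_snd, jmul, mk_snd, one, WithLp.smul_snd, smul_zero, wedge] at h2 ⊢
    -- The vector part of the equation is solved for `b.snd`; it then remains to compare the
    -- coefficients of `x.snd`, `s.snd` and `q.snd`.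
    have hb : b.snd = -(1 / x.fst) • (b.fst • x.snd
        + (s.fst • (scale x q).snd + (scale x q).fst • s.snd)) := by
      linear_combination (norm := skip) (1 / x.fst) • h2
      match_scalars <;> field_simp <;> ring
    rw [show (scale x b).snd = b.fst • x.snd + √(det x) • b.snd
      + (⟪x.snd, b.snd⟫ / (√(det x) + x.fst)) • x.snd from rfl, hb]
    simp only [scale, mk_fst, mk_snd, inner_add_right, inner_smul_right,
      real_inner_self_eq_norm_sq, hN]
    generalize √(det x) = β at *
    match_scalars
    · field_simp
      ring
    · field_simp
      ring
    · field_simp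
      ring

/-- The right side involves only ⟨x, b⟩ and det x · det b, both unchanged when a scaling is moved
from one member of the pair to the other. -/
lemma norm_scale_sub_sq {x b : Spin E} (hx : Pos x) (θ : ℝ) :
    ‖scale x b - θ • one‖ ^ 2 = (⟪x, b⟫ - θ) ^ 2 + ⟪x, b⟫ ^ 2 - det x * det b := by
  rw [← det_scale hx, norm_sq_eq]
  simp only [scale_fst, one, det, WithLp.sub_fst, WithLp.sub_snd, WithLp.smul_fst, WithLp.smul_snd,
    mk_fst, mk_snd, smul_zero, sub_zero, smul_eq_mul, mul_one]
  ring

/-- Both elements have first component ⟨x, b⟩ - θ, and their squared vector parts differ by the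
Cauchy–Schwarz deficit of `x.snd` and `b.snd`. -/
lemma norm_scale_sub_sq_le {x b : Spin E} (hx : Pos x) (θ : ℝ) :
    ‖scale x b - θ • one‖ ^ 2 ≤ ‖jmul x b - θ • one‖ ^ 2 := by
  rw [norm_scale_sub_sq hx, norm_sq_eq, inner_eq]
  have h1 : ⟪x.snd, b.snd⟫ ^ 2 ≤ ‖x.snd‖ ^ 2 * ‖b.snd‖ ^ 2 := by
    rw [← mul_pow, sq_le_sq, abs_of_nonneg (by positivity : 0 ≤ ‖x.snd‖ * ‖b.snd‖)]
    exact abs_real_inner_le_norm _ _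
  simp only [jmul, one, det, WithLp.sub_fst, WithLp.sub_snd, WithLp.smul_fst, WithLp.smul_snd,
    mk_fst, mk_snd, smul_zero, sub_zero, smul_eq_mul, mul_one]
  rw [norm_add_sq_real, norm_smul, norm_smul, inner_smul_left, inner_smul_right, mul_pow, mul_pow,
    Real.norm_eq_abs, Real.norm_eq_abs, sq_abs, sq_abs, real_inner_comm x.snd b.snd]
  simp only [conj_trivial]
  nlinarith

/-- The distance of a scaled pair from a multiple of the unit can be estimated in the coordinates
scaled by another element. -/
lemma norm_scale_scale_sub_sq_le {x q b : Spin E} (hx : Pos x) (hq : Pos q)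
    (hxq : Pos (scale x q)) (θ : ℝ) :
    ‖scale (scale x q) b - θ • one‖ ^ 2 ≤ ‖jmul q (scale x b) - θ • one‖ ^ 2 := by
  refine le_trans (le_of_eq ?_) (norm_scale_sub_sq_le hq θ)
  rw [norm_scale_sub_sq hxq, norm_scale_sub_sq hq, det_scale hx, det_scale hx, inner_scale_left]
  ring

lemma jmul_one (x : Spin E) : jmul x one = x := by
  apply ext' <;> simp [jmul, one]

lemma jmul_smul_right (x y : Spin E) (c : ℝ) : jmul x (c • y) = c • jmul x y := by
  apply ext'
  · simp [jmul, inner_smul_right]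
    ring
  · simp only [jmul, WithLp.smul_fst, WithLp.smul_snd, mk_snd, smul_eq_mul]
    module

/-- After a step along a scaled solution of the linearized complementarity equation, only the
second order terms contribute to the distance from the central path. -/
lemma norm_scale_scale_sub_sq_le_of_eq {x q b p t : Spin E} {μ θ : ℝ} (hx : Pos x)
    (hq : Pos (one + q)) (hxq : Pos (scale x (one + q))) (hb : scale x b = μ • one + p + t)
    (h : scale x b + μ • q = θ • one - jmul p q - wedge x p q) :
    ‖scale (scale x (one + q)) b - θ • one‖ ^ 2 ≤ ‖jmul q t - wedge x p q‖ ^ 2 := by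
  refine (norm_scale_scale_sub_sq_le hx hq hxq θ).trans (le_of_eq ?_)
  have hj : jmul (one + q) (scale x b) = scale x b + (μ • q + jmul p q + jmul q t) := by
    rw [jmul_comm, jmul_add_right, jmul_one, jmul_comm _ q, hb, jmul_add_right, jmul_add_right,
      jmul_smul_right, jmul_one, jmul_comm q p]
  rw [hj]
  congr 2
  linear_combination (norm := module) h

/-- Nonzero determinant alone does not separate the two half cones; the first component ⟨x, q⟩ of
T_x q decides the sign. -/
lemma Pos.scale {x q : Spin E} (hx : Pos x) (hq : Pos q) : Pos (scale x q) :=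
  pos_of_det_pos (by rw [det_scale hx]; exact mul_pos hx.det_pos hq.det_pos)
    (by rw [scale_fst]; exact hx.inner_pos hq)

lemma Pos.of_scale {x q : Spin E} (hx : Pos x) (hq : Pos (Spin.scale x q)) : Pos q := by
  refine pos_of_inner_pos hx ?_ (by rw [← scale_fst]; exact hq.fst_pos)
  have h := hq.det_pos
  rw [det_scale hx] at h
  exact pos_of_mul_pos_right h hx.det_pos.le

end Spin

/-! ### Products of spin factors and the estimates for one step -/

/-- A finite product of spin factors. -/
abbrev SpinProd {ι : Type*} (E : ι → Type*) : Type _ := PiLp 2 fun i => Spin (E i)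

namespace SpinProd

variable {ι : Type*} {E : ι → Type*} [∀ i, NormedAddCommGroup (E i)]

lemma norm_le_of_forall_sq_le [Fintype ι] {p q r : SpinProd E} {C : ℝ} (hC : 0 ≤ C)
    (h : ∀ i, ‖r i‖ ^ 2 ≤ C ^ 2 * ‖p i‖ ^ 2 * ‖q i‖ ^ 2) : ‖r‖ ≤ C * ‖p‖ * ‖q‖ := by
  refine le_of_sq_le_sq ?_ (by positivity)
  rw [PiLp.norm_sq_eq_of_L2, mul_pow, mul_pow, PiLp.norm_sq_eq_of_L2 _ q, Finset.mul_sum]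
  refine Finset.sum_le_sum fun i _ => (h i).trans ?_
  gcongr
  exact PiLp.norm_apply_le p i

variable [∀ i, InnerProductSpace ℝ (E i)]

/-- The unit element. -/
def one : SpinProd E := WithLp.toLp 2 fun _ => Spin.one

/-- The Jordan product. -/
def jmul (x y : SpinProd E) : SpinProd E := WithLp.toLp 2 fun i => Spin.jmul (x i) (y i)

/-- The blockwise scaling. -/
noncomputable def scale (x y : SpinProd E) : SpinProd E :=
  WithLp.toLp 2 fun i => Spin.scale (x i) (y i)

/-- The blockwise antisymmetric correction. -/
noncomputable def wedge (x p q : SpinProd E) : SpinProd E :=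
  WithLp.toLp 2 fun i => Spin.wedge (x i) (p i) (q i)

lemma exists_scale_eq {x : SpinProd E} (hx : ∀ i, Spin.Pos (x i)) (u : SpinProd E) :
    ∃ q, scale x q = u := by
  choose q hq using fun i => Spin.exists_scale_eq (hx i) (u i)
  exact ⟨WithLp.toLp 2 q, PiLp.ext hq⟩

lemma scale_add (x p q : SpinProd E) : scale x (p + q) = scale x p + scale x q :=
  PiLp.ext fun _ => Spin.scale_add _ _ _

/-- The complementarity equation, scaled by `x` and expanded around `μ • one`. -/
lemma scale_add_smul_eq {x s b q : SpinProd E} (hx : ∀ i, Spin.Pos (x i)) {θ : ℝ} (μ : ℝ)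
    (h : jmul x b + jmul s (scale x q) = θ • one) :
    scale x b + μ • q
      = θ • one - jmul (scale x s - μ • one) q - wedge x (scale x s - μ • one) q := by
  refine PiLp.ext fun i => ?_
  have h1 := Spin.scale_add_jmul_eq (hx i) (s := s i) (b := b i) (q := q i) (θ := θ)
    (congrArg (fun y : SpinProd E => y i) h)
  change Spin.scale (x i) (b i) + μ • q i = θ • Spin.one
    - Spin.jmul (Spin.scale (x i) (s i) - μ • Spin.one) (q i)
    - Spin.wedge (x i) (Spin.scale (x i) (s i) - μ • Spin.one) (q i)
  rw [← h1]
  generalize Spin.scale (x i) (s i) = w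
  -- The unit has no vector part, so the wedge sees only the deviation from μe; this makes the error
  -- term small near the central path.
  have hw : Spin.wedge (x i) (w - μ • Spin.one) (q i) = Spin.wedge (x i) w (q i) := by
    simp [Spin.wedge, Spin.one]
  have hj : Spin.jmul (w - μ • Spin.one) (q i) = Spin.jmul w (q i) - μ • q i := by
    apply Spin.ext'
    · simp [Spin.jmul, Spin.one]
      ring
    · simp only [Spin.jmul, Spin.one, Spin.mk_snd, WithLp.sub_snd, WithLp.smul_snd, WithLp.sub_fst,
        WithLp.smul_fst, Spin.mk_fst, smul_eq_mul]
      module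
  rw [hw, hj]
  abel

variable [Fintype ι]

lemma norm_jmul_le (p q : SpinProd E) : ‖jmul p q‖ ≤ √2 * ‖p‖ * ‖q‖ :=
  norm_le_of_forall_sq_le (by positivity) fun i => by
    rw [Real.sq_sqrt zero_le_two]
    exact Spin.norm_jmul_sq_le _ _

lemma norm_wedge_le {x : SpinProd E} (hx : ∀ i, Spin.Pos (x i)) (p q : SpinProd E) :
    ‖wedge x p q‖ ≤ 2 * ‖p‖ * ‖q‖ :=
  norm_le_of_forall_sq_le zero_le_two fun i => by
    rw [← mul_pow, ← mul_pow]
    exact pow_le_pow_left₀ (norm_nonneg _) (Spin.norm_wedge_le (hx i) _ _) 2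

lemma inner_scale_left (x p q : SpinProd E) : ⟪scale x p, q⟫ = ⟪p, scale x q⟫ := by
  simp only [PiLp.inner_apply]
  exact Finset.sum_congr rfl fun i _ => Spin.inner_scale_left _ _ _

/-- A symmetric surjective map is injective. -/
lemma eq_zero_of_scale_eq_zero {x v : SpinProd E} (hx : ∀ i, Spin.Pos (x i))
    (h : scale x v = 0) : v = 0 := by
  obtain ⟨q, hq⟩ := exists_scale_eq hx v
  rw [← inner_self_eq_zero (𝕜 := ℝ)]
  nth_rw 2 [← hq]
  rw [← inner_scale_left, h, inner_zero_left]

/-- The basic estimate of the scaled directions. -/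
lemma sq_add_sq_le {x p q v g : SpinProd E} {γ μ : ℝ} (hx : ∀ i, Spin.Pos (x i)) (hμ : 0 < μ)
    (hγ0 : 0 ≤ γ) (hγ : γ < 1 / 3) (hp : 2 * ‖p‖ ^ 2 ≤ (γ * μ) ^ 2) (hqv : ⟪q, v⟫ = 0)
    (h : v + μ • q = g - jmul p q - wedge x p q) :
    (1 - 3 * γ) ^ 2 * (μ ^ 2 * ‖q‖ ^ 2 + ‖v‖ ^ 2) ≤ ‖g‖ ^ 2 := by
  -- Pythagoras, by orthogonality of q and v.
  have h1 : ‖v + μ • q‖ ^ 2 = μ ^ 2 * ‖q‖ ^ 2 + ‖v‖ ^ 2 := by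
    rw [norm_add_sq_real, inner_smul_right, real_inner_comm, hqv, norm_smul, mul_pow,
      Real.norm_eq_abs, sq_abs]
    ring
  have hp' : √2 * ‖p‖ ≤ γ * μ := by
    refine le_of_sq_le_sq ?_ (by positivity)
    rwa [mul_pow, Real.sq_sqrt zero_le_two]
  -- The errors total at most (√2 + 2)‖p‖‖q‖ ≤ 3√2‖p‖‖q‖ ≤ 3γμ‖q‖, the source of the factor 1 - 3γ.
  have h2 : ‖v + μ • q‖ ≤ ‖g‖ + 3 * γ * (μ * ‖q‖) := by
    rw [h]
    have h3 := (norm_sub_le (g - jmul p q) (wedge x p q)).trans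
      (add_le_add (norm_sub_le _ _) (norm_wedge_le hx p q))
    have h4 := norm_jmul_le p q
    have h5 : (1 : ℝ) ≤ √2 := Real.one_le_sqrt.2 one_le_two
    have h6 := mul_le_mul_of_nonneg_right hp' (norm_nonneg q)
    have h7 : 0 ≤ (√2 - 1) * (‖p‖ * ‖q‖) := mul_nonneg (by linarith) (by positivity)
    nlinarith
  have h8 : μ * ‖q‖ ≤ ‖v + μ • q‖ := by
    refine le_of_sq_le_sq ?_ (norm_nonneg _)
    rw [h1, mul_pow]
    nlinarith [sq_nonneg ‖v‖]
  rw [← h1, ← mul_pow]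
  refine pow_le_pow_left₀ (mul_nonneg (by linarith) (norm_nonneg _)) ?_ 2
  nlinarith [mul_le_mul_of_nonneg_left h8 (by linarith : 0 ≤ 3 * γ)]

/-- The linearized complementarity equation has only the trivial orthogonal homogeneous solution
near the central path. -/
theorem eq_zero_of_jmul_add_jmul_eq_zero {x s u v : SpinProd E} {γ μ : ℝ}
    (hx : ∀ i, Spin.Pos (x i)) (hμ : 0 < μ) (hγ0 : 0 ≤ γ) (hγ : γ < 1 / 3)
    (hp : 2 * ‖scale x s - μ • one‖ ^ 2 ≤ (γ * μ) ^ 2) (huv : ⟪u, v⟫ = 0)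
    (h : jmul x v + jmul s u = 0) : u = 0 ∧ v = 0 := by
  obtain ⟨q, rfl⟩ := exists_scale_eq hx u
  have h1 := scale_add_smul_eq hx (θ := 0) μ (by rw [h, zero_smul])
  rw [inner_scale_left] at huv
  have h2 := sq_add_sq_le hx hμ hγ0 hγ hp huv h1
  rw [zero_smul, norm_zero, zero_pow two_ne_zero] at h2
  have h3 : μ ^ 2 * ‖q‖ ^ 2 + ‖scale x v‖ ^ 2 ≤ 0 := by
    by_contra! h4
    have : 0 < (1 - 3 * γ) ^ 2 := by
      have : 0 < 1 - 3 * γ := by linarith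
      positivity
    nlinarith
  have hq : q = 0 := by
    have : μ ^ 2 * ‖q‖ ^ 2 = 0 := le_antisymm (by nlinarith [sq_nonneg ‖scale x v‖]) (by positivity)
    simpa [hμ.ne'] using this
  have hv : scale x v = 0 := by
    have : ‖scale x v‖ ^ 2 = 0 := le_antisymm (by nlinarith [sq_nonneg (μ * ‖q‖)]) (by positivity)
    simpa using this
  refine ⟨?_, eq_zero_of_scale_eq_zero hx hv⟩
  rw [hq]
  exact PiLp.ext fun i => Spin.scale_zero _

/-- P, Q, R, G stand for the norms of p, q, t, g. The three conclusions serve positivity of e + q,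
positivity of μe + p + t, and the distance bound at the new point. -/
lemma step_estimates {P Q R G γ δ μ θ : ℝ} (hP : 0 ≤ P) (hQ : 0 ≤ Q) (hR : 0 ≤ R) (hμ : 0 < μ)
    (hγ0 : 0 < γ) (hγ : γ < 1 / 3) (hθ : θ ≤ μ) (hp : 2 * P ^ 2 ≤ (γ * μ) ^ 2)
    (hG : 2 * G ^ 2 ≤ (γ ^ 2 + δ ^ 2) * μ ^ 2)
    (hpar : 4 * (γ ^ 2 + δ ^ 2) / (1 - 3 * γ) ^ 2 * μ ≤ γ * θ)
    (h : (1 - 3 * γ) ^ 2 * (μ ^ 2 * Q ^ 2 + R ^ 2) ≤ G ^ 2) :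
    2 * Q ^ 2 < 1 ^ 2 ∧ 2 * (P + R) ^ 2 < μ ^ 2 ∧
      2 * (√2 * Q * R + 2 * P * Q) ^ 2 ≤ (γ * θ) ^ 2 := by
  have hc : 0 < (1 - 3 * γ) ^ 2 := pow_pos (by linarith) 2
  obtain ⟨K, hK⟩ : ∃ K, K = (γ ^ 2 + δ ^ 2) / (1 - 3 * γ) ^ 2 := ⟨_, rfl⟩
  rw [mul_div_assoc, ← hK] at hpar
  have hγK : γ ^ 2 ≤ K := by
    rw [hK, le_div_iff₀ hc]
    nlinarith [sq_nonneg δ, mul_nonneg (sq_nonneg γ) (by nlinarith : 0 ≤ 1 - (1 - 3 * γ) ^ 2)]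
  have hK0 : 0 < K := (pow_pos hγ0 2).trans_le hγK
  -- The parameter condition and θ ≤ μ give 4K ≤ γ < 1/3.
  have hK1 : K < 1 / 12 := by
    have h1 : 4 * K * μ ≤ γ * μ := hpar.trans (mul_le_mul_of_nonneg_left hθ hγ0.le)
    have h2 := le_of_mul_le_mul_right h1 hμ
    linarith
  have h4 : 2 * (μ ^ 2 * Q ^ 2 + R ^ 2) ≤ K * μ ^ 2 := by
    rw [hK, div_mul_eq_mul_div, le_div_iff₀ hc]
    linarith
  have hμ2 : 0 < μ ^ 2 := by positivity
  have hp' : 2 * P ^ 2 ≤ K * μ ^ 2 := by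
    rw [mul_pow] at hp
    exact hp.trans (mul_le_mul_of_nonneg_right hγK hμ2.le)
  refine ⟨?_, ?_, ?_⟩
  · have h6 : μ ^ 2 * (2 * Q ^ 2) ≤ μ ^ 2 * K := by linarith [sq_nonneg R]
    linarith [le_of_mul_le_mul_left h6 hμ2]
  · have h7 : γ ^ 2 * μ ^ 2 ≤ 1 / 9 * μ ^ 2 := by
      gcongr
      nlinarith
    have h8 : K * μ ^ 2 ≤ 1 / 12 * μ ^ 2 := by gcongr
    rw [mul_pow] at hp
    linarith [sq_nonneg (P - R), sq_nonneg (P + R), mul_nonneg hμ2.le (sq_nonneg Q),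
      show (P - R) ^ 2 + (P + R) ^ 2 = 2 * (P ^ 2 + R ^ 2) by ring]
  · have hqt : μ * (Q * R) ≤ μ * (K * μ / 4) := by
      have := sq_nonneg (μ * Q - R)
      linarith [show (μ * Q - R) ^ 2 = μ ^ 2 * Q ^ 2 + R ^ 2 - 2 * (μ * (Q * R)) by ring,
        show μ * (K * μ / 4) = K * μ ^ 2 / 4 by ring]
    have hpq : μ * (P * Q) ≤ μ * (K * μ / 2) := by
      have := sq_nonneg (μ * Q - P)
      linarith [sq_nonneg R,
        show (μ * Q - P) ^ 2 = μ ^ 2 * Q ^ 2 + P ^ 2 - 2 * (μ * (P * Q)) by ring,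
        show μ * (K * μ / 2) = K * μ ^ 2 / 2 by ring]
    replace hqt := le_of_mul_le_mul_left hqt hμ
    replace hpq := le_of_mul_le_mul_left hpq hμ
    have h2' : √2 ≤ 3 / 2 := Real.sqrt_le_iff.2 ⟨by norm_num, by norm_num⟩
    have h9 := mul_le_mul_of_nonneg_right h2' (mul_nonneg hQ hR)
    have hKμ : 0 < K * μ := mul_pos hK0 hμ
    -- QR ≤ Kμ/4 and PQ ≤ Kμ/2 give at most (3/2 · 1/4 + 1)Kμ = 11/8 · Kμ, rounded up to 2Kμ; the 4
    -- of the parameter condition then absorbs 2√2.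
    have hR' : √2 * Q * R + 2 * P * Q ≤ 2 * (K * μ) := by linarith
    calc 2 * (√2 * Q * R + 2 * P * Q) ^ 2 ≤ 2 * (2 * (K * μ)) ^ 2 := by gcongr
      _ ≤ (4 * K * μ) ^ 2 := by nlinarith [sq_nonneg (K * μ)]
      _ ≤ (γ * θ) ^ 2 := by gcongr

/-- A full step along an orthogonal direction stays in the neighbourhood of the central path. -/
theorem pos_and_norm_scale_sub_le {x s u v : SpinProd E} {γ δ μ θ : ℝ}
    (hx : ∀ i, Spin.Pos (x i)) (hμ : 0 < μ) (hγ0 : 0 < γ) (hγ : γ < 1 / 3) (hθ : θ ≤ μ)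
    (hp : 2 * ‖scale x s - μ • one‖ ^ 2 ≤ (γ * μ) ^ 2)
    (hg : 2 * ‖(θ - μ) • one - (scale x s - μ • one)‖ ^ 2 ≤ (γ ^ 2 + δ ^ 2) * μ ^ 2)
    (hpar : 4 * (γ ^ 2 + δ ^ 2) / (1 - 3 * γ) ^ 2 * μ ≤ γ * θ) (huv : ⟪u, v⟫ = 0)
    (h : jmul x v + jmul s u = θ • one - jmul x s) :
    (∀ i, Spin.Pos ((x + u) i)) ∧ (∀ i, Spin.Pos ((s + v) i)) ∧
      2 * ‖scale (x + u) (s + v) - θ • one‖ ^ 2 ≤ (γ * θ) ^ 2 := by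
  obtain ⟨q, rfl⟩ := exists_scale_eq hx u
  have hb : jmul x (s + v) + jmul s (scale x q) = θ • one := by
    have : jmul x (s + v) = jmul x s + jmul x v := PiLp.ext fun _ => Spin.jmul_add_right _ _ _
    rw [this, add_assoc, h]
    abel
  have h1 := scale_add_smul_eq hx μ hb
  rw [inner_scale_left] at huv
  have hsv := scale_add x s v
  set w := scale x s
  set t := scale x v
  set p := w - μ • one with hpdef
  have h2 : t + μ • q = ((θ - μ) • one - p) - jmul p q - wedge x p q := by
    rw [hsv] at h1
    rw [eq_sub_of_add_eq' ((add_assoc _ _ _).symm.trans h1), hpdef]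
    module
  have h3 := sq_add_sq_le hx hμ hγ0.le hγ hp huv h2
  obtain ⟨e1, e2, e3⟩ := step_estimates (norm_nonneg p) (norm_nonneg q) (norm_nonneg t) hμ hγ0 hγ hθ
    hp hg hpar h3
  have hposq (i : ι) : Spin.Pos (Spin.one + q i) := by
    rw [← one_smul ℝ Spin.one]
    refine Spin.pos_one_add one_pos ?_
    refine lt_of_le_of_lt ?_ e1
    gcongr
    exact PiLp.norm_apply_le q i
  have hx' (i : ι) : (x + scale x q) i = Spin.scale (x i) (Spin.one + q i) := by
    rw [Spin.scale_add, Spin.scale_one]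
    rfl
  have hposx (i : ι) : Spin.Pos ((x + scale x q) i) := by
    rw [hx']
    exact (hx i).scale (hposq i)
  have hsv' : scale x (s + v) = μ • one + p + t := by
    rw [hsv, hpdef]
    abel
  -- Positivity of s + v is read off from T_x(s + v) = μe + p + t, since T_x reflects positivity.
  have hposs (i : ι) : Spin.Pos ((s + v) i) := by
    refine Spin.Pos.of_scale (hx i) ?_
    have h5 : Spin.scale (x i) ((s + v) i) = μ • Spin.one + (p + t) i := by
      rw [add_assoc] at hsv'
      exact congrArg (fun y : SpinProd E => y i) hsv'
    rw [h5]
    refine Spin.pos_one_add hμ ?_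
    refine lt_of_le_of_lt ?_ e2
    gcongr
    exact (PiLp.norm_apply_le _ i).trans (norm_add_le _ _)
  refine ⟨hposx, hposs, ?_⟩
  have hr : ‖scale (x + scale x q) (s + v) - θ • one‖ ^ 2 ≤ ‖jmul q t - wedge x p q‖ ^ 2 := by
    rw [PiLp.norm_sq_eq_of_L2, PiLp.norm_sq_eq_of_L2]
    refine Finset.sum_le_sum fun i _ => ?_
    have h5 := hposx i
    rw [hx'] at h5
    have h6 := Spin.norm_scale_scale_sub_sq_le_of_eq (hx i) (hposq i) h5
      (congrArg (fun y : SpinProd E => y i) hsv') (congrArg (fun y : SpinProd E => y i) h1)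
    rw [← hx'] at h6
    exact h6
  have hR := (norm_sub_le (jmul q t) (wedge x p q)).trans
    (add_le_add (norm_jmul_le q t) (norm_wedge_le hx p q))
  exact le_trans (mul_le_mul_of_nonneg_left
    (hr.trans (pow_le_pow_left₀ (norm_nonneg _) hR 2)) zero_le_two) e3

end SpinProd

/-! ### Translation between coordinates and spin factors -/

namespace SOCP

open Matrix
/-- A block as an element of a spin factor. -/
noncomputable def ofBlock {m : ℕ} (u : Fin (m + 1) → ℝ) : Spin (EuclideanSpace ℝ (Fin m)) :=
  Spin.mk (u 0) (WithLp.toLp 2 (Fin.tail u))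

lemma inner_ofBlock {m : ℕ} (u v : Fin (m + 1) → ℝ) : ⟪ofBlock u, ofBlock v⟫ = u ⬝ᵥ v := by
  rw [Spin.inner_eq, dotProduct, Fin.sum_univ_succ]
  simp [ofBlock, PiLp.inner_apply, Fin.tail, mul_comm]

lemma inner_tail {m : ℕ} (u v : Fin (m + 1) → ℝ) :
    ⟪(ofBlock u).snd, (ofBlock v).snd⟫ = ∑ a : Fin m, u a.succ * v a.succ := by
  simp [ofBlock, PiLp.inner_apply, Fin.tail, mul_comm]

lemma ofBlock_arrow_mulVec {m : ℕ} (u v : Fin (m + 1) → ℝ) :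
    ofBlock (arrow u *ᵥ v) = Spin.jmul (ofBlock u) (ofBlock v) := by
  apply Spin.ext'
  · rw [Spin.jmul, Spin.mk_fst, inner_tail]
    simp [ofBlock, arrow, mulVec, dotProduct, Fin.sum_univ_succ]
  · ext a
    simp [Spin.jmul, ofBlock, arrow, mulVec, dotProduct, Fin.sum_univ_succ, Fin.tail, Fin.succ_ne_zero]
    ring

lemma ofBlock_Tblock_mulVec {m : ℕ} (u v : Fin (m + 1) → ℝ) :
    ofBlock (Tblock u *ᵥ v) = Spin.scale (ofBlock u) (ofBlock v) := by
  have hβ : √(Spin.det (ofBlock u)) = beta u := rfl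
  apply Spin.ext'
  · rw [Spin.scale, Spin.mk_fst, inner_tail]
    simp [ofBlock, Tblock, mulVec, dotProduct, Fin.sum_univ_succ]
  · rw [Spin.scale, Spin.mk_snd, inner_tail, hβ]
    ext a
    simp only [ofBlock, Tblock, mulVec, dotProduct, Fin.sum_univ_succ, Fin.tail, Spin.mk_snd,
      Spin.mk_fst, Matrix.of_apply, Fin.succ_ne_zero, if_true, if_false, PiLp.add_apply,
      PiLp.smul_apply, smul_eq_mul, Fin.succ_inj, add_mul, Finset.sum_add_distrib, ite_mul, zero_mul,
      Finset.sum_ite_eq, Finset.mem_univ]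
    rw [Finset.sum_div, Finset.sum_mul, ← add_assoc, mul_comm (u a.succ)]
    congr 1
    exact Finset.sum_congr rfl fun b _ => by ring

lemma block_blockDiagonal'_mulVec {k : ℕ} {d : Fin k → ℕ}
    (M : ∀ i, Matrix (Fin (d i + 1)) (Fin (d i + 1)) ℝ) (v : Vec d) (i : Fin k) :
    block (Matrix.blockDiagonal' M *ᵥ v) i = M i *ᵥ block v i := by
  ext a
  simp only [block, mulVec, dotProduct, Fintype.sum_sigma]
  rw [Finset.sum_eq_single i]
  · exact Finset.sum_congr rfl fun b _ => by rw [Matrix.blockDiagonal'_apply_eq]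
  · intro j _ hj
    exact Finset.sum_eq_zero fun b _ => by
      rw [Matrix.blockDiagonal'_apply_ne _ _ _ hj.symm, zero_mul]
  · simp

/-- A real number as an element of the one-dimensional spin factor. -/
noncomputable def ofScalar (c : ℝ) : Spin (EuclideanSpace ℝ (Fin 0)) := Spin.mk c 0

lemma ofScalar_ext {x : Spin (EuclideanSpace ℝ (Fin 0))} {c : ℝ} (h : x.fst = c) :
    x = ofScalar c :=
  Spin.ext' h (Subsingleton.elim _ _)

lemma inner_ofScalar (a b : ℝ) : ⟪ofScalar a, ofScalar b⟫ = a * b := by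
  simp [ofScalar, mul_comm]

lemma jmul_ofScalar (a b : ℝ) : Spin.jmul (ofScalar a) (ofScalar b) = ofScalar (a * b) :=
  ofScalar_ext (by simp [Spin.jmul, ofScalar])

lemma scale_ofScalar (a b : ℝ) : Spin.scale (ofScalar a) (ofScalar b) = ofScalar (a * b) :=
  ofScalar_ext (by simp [Spin.scale, ofScalar])

lemma ofScalar_add (a b : ℝ) : ofScalar (a + b) = ofScalar a + ofScalar b :=
  Spin.ext' rfl (Subsingleton.elim _ _)

lemma ofScalar_sub (a b : ℝ) : ofScalar (a - b) = ofScalar a - ofScalar b :=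
  Spin.ext' rfl (Subsingleton.elim _ _)

lemma ofScalar_smul (r a : ℝ) : ofScalar (r * a) = r • ofScalar a :=
  Spin.ext' rfl (Subsingleton.elim _ _)

lemma pos_ofScalar_iff (c : ℝ) : Spin.Pos (ofScalar c) ↔ 0 < c := by
  simp [Spin.Pos, ofScalar]

/-- The dimensions of the tails of all blocks, including the one of the homogenizing variable. -/
abbrev tailDim {k : ℕ} (d : Fin k → ℕ) (o : Option (Fin k)) : ℕ := o.elim 0 d

/-- The product of spin factors which contains the pairs `(x, τ)` and `(s, κ)`. -/
abbrev Ambient {k : ℕ} (d : Fin k → ℕ) : Type :=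
  SpinProd fun o : Option (Fin k) => EuclideanSpace ℝ (Fin (tailDim d o))

/-- The pair `(v, c)` as an element of a product of spin factors. -/
noncomputable def lift {k : ℕ} {d : Fin k → ℕ} (v : Vec d) (c : ℝ) : Ambient d :=
  WithLp.toLp 2 fun o => match o with
    | none => ofScalar c
    | some i => ofBlock (block v i)

section lift

variable {k : ℕ} {d : Fin k → ℕ}

lemma lift_ext {x y : Ambient d} (h₀ : x none = y none) (h : ∀ i, x (some i) = y (some i)) :
    x = y :=
  PiLp.ext fun o => match o with
    | none => h₀
    | some i => h i

lemma inner_lift (x s : Vec d) (τ κ : ℝ) : ⟪lift x τ, lift s κ⟫ = x ⬝ᵥ s + τ * κ := by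
  rw [PiLp.inner_apply, Fintype.sum_option, dotProduct, Fintype.sum_sigma, add_comm]
  congr 1
  · exact Finset.sum_congr rfl fun i _ => inner_ofBlock (block x i) (block s i)
  · exact inner_ofScalar τ κ

lemma lift_add (x u : Vec d) (τ σ : ℝ) : lift (x + u) (τ + σ) = lift x τ + lift u σ :=
  lift_ext (ofScalar_add τ σ) fun _ => rfl

lemma lift_smul (r : ℝ) (x : Vec d) (τ : ℝ) : lift (r • x) (r * τ) = r • lift x τ :=
  lift_ext (ofScalar_smul r τ) fun _ => rfl

lemma lift_sub (x u : Vec d) (τ σ : ℝ) : lift (x - u) (τ - σ) = lift x τ - lift u σ :=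
  lift_ext (ofScalar_sub τ σ) fun _ => rfl

lemma lift_unit : lift (unit d) 1 = SpinProd.one := by
  refine lift_ext rfl fun i => ?_
  change ofBlock (block (unit d) i) = Spin.one
  apply Spin.ext'
  · simp [ofBlock, block, unit, Spin.one]
  · ext a
    simp [ofBlock, block, unit, Spin.one, Fin.tail]

lemma norm_sq_lift (x : Vec d) (τ : ℝ) : ‖lift x τ‖ ^ 2 = x ⬝ᵥ x + τ * τ := by
  rw [← real_inner_self_eq_norm_sq, inner_lift]

lemma lift_eq_zero {x : Vec d} {τ : ℝ} (h : lift x τ = 0) : x = 0 ∧ τ = 0 := by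
  have h1 := norm_sq_lift x τ
  rw [h, norm_zero, zero_pow two_ne_zero] at h1
  have h2 : 0 ≤ x ⬝ᵥ x := Finset.sum_nonneg fun i _ => mul_self_nonneg _
  exact ⟨dotProduct_self_eq_zero.1 (by nlinarith [mul_self_nonneg τ]),
    mul_self_eq_zero.1 (by nlinarith [mul_self_nonneg τ])⟩

lemma jmul_lift (x s : Vec d) (τ κ : ℝ) :
    SpinProd.jmul (lift x τ) (lift s κ) = lift (mat x *ᵥ s) (τ * κ) := by
  refine lift_ext ?_ fun i => ?_
  · exact jmul_ofScalar τ κ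
  · change Spin.jmul (ofBlock (block x i)) (ofBlock (block s i)) = ofBlock (block (mat x *ᵥ s) i)
    rw [mat, block_blockDiagonal'_mulVec, ofBlock_arrow_mulVec]

lemma scale_lift (x s : Vec d) (τ κ : ℝ) :
    SpinProd.scale (lift x τ) (lift s κ) = lift (T x *ᵥ s) (τ * κ) := by
  refine lift_ext ?_ fun i => ?_
  · exact scale_ofScalar τ κ
  · change Spin.scale (ofBlock (block x i)) (ofBlock (block s i)) = ofBlock (block (T x *ᵥ s) i)
    rw [T, block_blockDiagonal'_mulVec, ofBlock_Tblock_mulVec]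

/-- Turns mat(x) mat(s) e in the complementarity equation into the Jordan product of x and s. -/
lemma mat_mulVec_unit (s : Vec d) : mat s *ᵥ unit d = s := by
  have h : lift (mat s *ᵥ unit d - s) ((0 : ℝ) * 1 - 0) = 0 := by
    rw [lift_sub, ← jmul_lift, lift_unit, sub_eq_zero]
    exact PiLp.ext fun _ => Spin.jmul_one _
  exact sub_eq_zero.1 (lift_eq_zero h).1

lemma pos_lift_iff (x : Vec d) (τ : ℝ) : (∀ o, Spin.Pos (lift x τ o)) ↔
    (∀ i, norm2 (Fin.tail (block x i)) < block x i 0) ∧ 0 < τ := by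
  constructor
  · intro h
    exact ⟨fun i => h (some i), (pos_ofScalar_iff τ).1 (h none)⟩
  · rintro ⟨h, h0⟩ (_ | i)
    · exact (pos_ofScalar_iff τ).2 h0
    · exact h i

lemma continuous_norm2 {ι : Type} [Fintype ι] : Continuous (norm2 : (ι → ℝ) → ℝ) :=
  continuous_norm.comp (PiLp.continuous_toLp 2 fun _ : ι => ℝ)

lemma mem_interior_bigCone_iff {p : ℕ} (z : Point p d) : z ∈ interior (bigCone p d) ↔
    (∀ o, Spin.Pos (lift z.x z.τ o)) ∧ ∀ o, Spin.Pos (lift z.s z.κ o) := by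
  rw [pos_lift_iff, pos_lift_iff]
  constructor
  · intro hz
    -- An interior point stays in the cone after subtracting a small positive multiple of (e, 0, e,
    -- 1, 1), which makes every cone inequality strict.
    have hc : Continuous fun t : ℝ => z - t • ((unit d, 0, unit d, 1, 1) : Point p d) := by
      fun_prop
    have h1 := hc.continuousAt.preimage_mem_nhds (x := 0)
      (by simpa using mem_interior_iff_mem_nhds.1 hz)
    obtain ⟨t, ht0, ht⟩ := Filter.nonempty_of_mem (Filter.inter_mem
      (mem_nhdsWithin_of_mem_nhds h1) (self_mem_nhdsWithin (s := Set.Ioi (0 : ℝ))))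
    obtain ⟨hx, hs, hκ, hτ⟩ := ht0
    have ht' : (0 : ℝ) < t := ht
    have key (v : Vec d) (i : Fin k) (h : block (v - t • unit d) i ∈ socone (d i)) :
        norm2 (Fin.tail (block v i)) < block v i 0 := by
      have e : Fin.tail (block (v - t • unit d) i) = Fin.tail (block v i) := by
        ext a
        simp [block, unit, Fin.tail]
      have e' : block (v - t • unit d) i 0 = block v i 0 - t := by
        simp [block, unit]
      have h2 : norm2 (Fin.tail (block (v - t • unit d) i)) ≤ block (v - t • unit d) i 0 := h
      rw [e, e'] at h2
      linarith
    refine ⟨⟨fun i => key _ i (hx i), ?_⟩, fun i => key _ i (hs i), ?_⟩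
    · have : 0 ≤ z.τ - t * 1 := hτ
      linarith
    · have : 0 ≤ z.κ - t * 1 := hκ
      linarith
  · rintro ⟨⟨hx, hτ⟩, hs, hκ⟩
    have hopen : IsOpen {z : Point p d | ((∀ i, norm2 (Fin.tail (block z.x i)) < block z.x i 0) ∧
        0 < z.τ) ∧ (∀ i, norm2 (Fin.tail (block z.s i)) < block z.s i 0) ∧ 0 < z.κ} := by
      have hb (i : Fin k) : Continuous fun v : Vec d => block v i :=
        continuous_pi fun a => continuous_apply _
      have ht (i : Fin k) : Continuous fun v : Vec d => norm2 (Fin.tail (block v i)) :=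
        continuous_norm2.comp (continuous_pi fun a => continuous_apply _)
      have h0 (i : Fin k) : Continuous fun v : Vec d => block v i 0 := continuous_apply _
      simp only [Set.ofPred_and, Set.ofPred_forall]
      refine ((isOpen_iInter_of_finite fun i => isOpen_lt ((ht i).comp continuous_fst)
        ((h0 i).comp continuous_fst)).inter (isOpen_lt continuous_const (by fun_prop))).inter
        ((isOpen_iInter_of_finite fun i => isOpen_lt ((ht i).comp (by fun_prop))
        ((h0 i).comp (by fun_prop))).inter (isOpen_lt continuous_const (by fun_prop)))
    refine interior_maximal ?_ hopen ⟨⟨hx, hτ⟩, hs, hκ⟩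
    rintro y ⟨⟨hx, hτ⟩, hs, hκ⟩
    exact ⟨fun i => (hx i).le, fun i => (hs i).le, hκ.le, hτ.le⟩

end lift

end SOCP

/-! ### The search direction and the neighbourhood -/

namespace SOCP

open Matrix
variable {k p : ℕ} {d : Fin k → ℕ}

namespace Point

variable (z w : Point p d) (r : ℝ)

lemma add_x : (z + w).x = z.x + w.x := rfl

lemma add_y : (z + w).y = z.y + w.y := rfl

lemma add_s : (z + w).s = z.s + w.s := rfl

lemma add_κ : (z + w).κ = z.κ + w.κ := rfl

lemma add_τ : (z + w).τ = z.τ + w.τ := rfl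

lemma smul_x : (r • z).x = r • z.x := rfl

lemma smul_y : (r • z).y = r • z.y := rfl

lemma smul_s : (r • z).s = r • z.s := rfl

lemma smul_κ : (r • z).κ = r * z.κ := rfl

lemma smul_τ : (r • z).τ = r * z.τ := rfl

end Point

lemma norm2_sq {ι : Type} [Fintype ι] (v : ι → ℝ) : norm2 v ^ 2 = v ⬝ᵥ v := by
  rw [norm2, EuclideanSpace.real_norm_sq_eq]
  exact Finset.sum_congr rfl fun i _ => sq _

lemma norm2_smul {ι : Type} [Fintype ι] (r : ℝ) (v : ι → ℝ) : norm2 (r • v) = |r| * norm2 v := by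
  rw [norm2, WithLp.toLp_smul, norm_smul, Real.norm_eq_abs, norm2]

lemma norm2_sumElim_sq (v : Vec d) (c : ℝ) :
    norm2 (Sum.elim v fun _ : Unit => c) ^ 2 = ‖lift v c‖ ^ 2 := by
  rw [norm2_sq, norm_sq_lift]
  simp [dotProduct]

lemma mu_eq (z : Point p d) : mu z = ⟪lift z.x z.τ, lift z.s z.κ⟫ / ((k : ℝ) + 1) := by
  rw [mu, inner_lift, mul_comm z.κ]

lemma dist2_sq (z : Point p d) : dist2 z ^ 2
    = 2 * ‖SpinProd.scale (lift z.x z.τ) (lift z.s z.κ) - mu z • SpinProd.one‖ ^ 2 := by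
  have h : (Sum.elim (T z.x *ᵥ z.s) (fun _ : Unit => z.κ * z.τ)
      - mu z • Sum.elim (unit d) (fun _ : Unit => 1))
      = Sum.elim (T z.x *ᵥ z.s - mu z • unit d) (fun _ : Unit => z.τ * z.κ - mu z * 1) := by
    ext (i | i) <;> simp [mul_comm]
  rw [dist2, mul_pow, Real.sq_sqrt zero_le_two, h, norm2_sumElim_sq, lift_sub, lift_smul, lift_unit,
    scale_lift]

lemma norm_one_sq : ‖(SpinProd.one : Ambient d)‖ ^ 2 = (k : ℝ) + 1 := by
  have h (o : Option (Fin k)) : ‖(SpinProd.one : Ambient d) o‖ ^ 2 = 1 := by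
    change ‖(Spin.one : Spin (EuclideanSpace ℝ (Fin (tailDim d o))))‖ ^ 2 = 1
    rw [Spin.norm_sq_eq]
    simp [Spin.one]
  rw [PiLp.norm_sq_eq_of_L2]
  simp [h]

/-- T_x is symmetric and T_x e = x. -/
lemma inner_one_scale (x s : Ambient d) : ⟪SpinProd.one, SpinProd.scale x s⟫ = ⟪x, s⟫ := by
  rw [← SpinProd.inner_scale_left,
    show SpinProd.scale x SpinProd.one = x from PiLp.ext fun _ => Spin.scale_one _]

lemma inner_one_jmul (x s : Ambient d) : ⟪SpinProd.one, SpinProd.jmul x s⟫ = ⟪x, s⟫ := by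
  rw [PiLp.inner_apply, PiLp.inner_apply]
  refine Finset.sum_congr rfl fun o _ => ?_
  change ⟪Spin.one, Spin.jmul (x o) (s o)⟫ = _
  rw [Spin.inner_eq, Spin.inner_eq]
  simp [Spin.one, Spin.jmul]

lemma mu_pos {z : Point p d} (hz : z ∈ interior (bigCone p d)) : 0 < mu z := by
  rw [mem_interior_bigCone_iff] at hz
  rw [mu_eq]
  refine div_pos ?_ (by positivity)
  rw [PiLp.inner_apply]
  exact Finset.sum_pos (fun o _ => (hz.1 o).inner_pos (hz.2 o)) Finset.univ_nonempty

lemma inner_lift_eq_mu (z : Point p d) :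
    ⟪lift z.x z.τ, lift z.s z.κ⟫ = mu z * ((k : ℝ) + 1) := by
  rw [mu_eq, div_mul_cancel₀ _ (by positivity)]

/-- Membership in the neighbourhood of the central path in terms of spin factors. -/
lemma mem_N2_iff {γ : ℝ} (hγ : 0 ≤ γ) (z : Point p d) : z ∈ N2 p d γ ↔
    (∀ o, Spin.Pos (lift z.x z.τ o)) ∧ (∀ o, Spin.Pos (lift z.s z.κ o)) ∧
      2 * ‖SpinProd.scale (lift z.x z.τ) (lift z.s z.κ) - mu z • SpinProd.one‖ ^ 2
        ≤ (γ * mu z) ^ 2 := by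
  rw [← and_assoc, ← mem_interior_bigCone_iff, ← dist2_sq]
  refine and_congr_right fun hz => ?_
  rw [pow_le_pow_iff_left₀ _ (mul_nonneg hγ (mu_pos hz).le) two_ne_zero]
  exact mul_nonneg (Real.sqrt_nonneg _) (norm_nonneg _)

/-- The left-hand side of the linear system for the unscaled search direction at `z`. -/
def directionMap (P : Problem p d) (z : Point p d) :
    Point p d →ₗ[ℝ] (Fin p → ℝ) × Vec d × ℝ × Vec d × ℝ where
  toFun Δ := (P.A *ᵥ Δ.x - Δ.τ • P.b, -(P.Aᵀ *ᵥ Δ.y) + Δ.τ • P.c - Δ.s,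
    P.b ⬝ᵥ Δ.y - P.c ⬝ᵥ Δ.x - Δ.κ, mat z.x *ᵥ Δ.s + mat z.s *ᵥ Δ.x, z.κ * Δ.τ + z.τ * Δ.κ)
  map_add' Δ Δ' := by
    simp only [Point.add_x, Point.add_y, Point.add_s, Point.add_κ, Point.add_τ, mulVec_add,
      dotProduct_add, Prod.mk_add_mk, Prod.mk.injEq]
    refine ⟨?_, ?_, ?_, ?_, ?_⟩
    · module
    · module
    · ring
    · module
    · ring
  map_smul' r Δ := by
    simp only [Point.smul_x, Point.smul_y, Point.smul_s, Point.smul_κ, Point.smul_τ, mulVec_smul, dotProduct_smul, Prod.smul_mk,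
      Prod.mk.injEq, RingHom.id_apply, smul_eq_mul]
    refine ⟨?_, ?_, ?_, ?_, ?_⟩
    · module
    · module
    · ring
    · module
    · ring

lemma isDirection_iff (P : Problem p d) (ν : ℝ) (z Δ : Point p d) :
    IsDirection P ν 1 z Δ ↔ directionMap P z Δ =
      (-((1 - ν) • (P.A *ᵥ z.x - z.τ • P.b)),
        -((1 - ν) • (-(P.Aᵀ *ᵥ z.y) + z.τ • P.c - z.s)),
        -((1 - ν) * (P.b ⬝ᵥ z.y - P.c ⬝ᵥ z.x - z.κ)),
        (ν * mu z) • unit d - mat z.x *ᵥ z.s, ν * mu z - z.κ * z.τ) := by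
  simp [IsDirection, directionMap, mat_mulVec_unit]

/-- The homogeneous part of the linear system is skew-symmetric. -/
lemma dotProduct_add_mul_eq_zero (P : Problem p d) {z : Point p d}
    (h₁ : P.A *ᵥ z.x - z.τ • P.b = 0) (h₂ : -(P.Aᵀ *ᵥ z.y) + z.τ • P.c - z.s = 0)
    (h₃ : P.b ⬝ᵥ z.y - P.c ⬝ᵥ z.x - z.κ = 0) : z.x ⬝ᵥ z.s + z.τ * z.κ = 0 := by
  have hs : z.s = -(P.Aᵀ *ᵥ z.y) + z.τ • P.c := (sub_eq_zero.1 h₂).symm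
  have hA : z.x ⬝ᵥ (P.Aᵀ *ᵥ z.y) = z.τ * (P.b ⬝ᵥ z.y) := by
    rw [mulVec_transpose, dotProduct_comm, ← dotProduct_mulVec, sub_eq_zero.1 h₁, dotProduct_smul,
      dotProduct_comm, smul_eq_mul]
  rw [hs, dotProduct_add, dotProduct_neg, hA, dotProduct_smul, dotProduct_comm z.x, smul_eq_mul]
  linear_combination -z.τ * h₃

lemma jmul_add_jmul_lift (z Δ : Point p d) :
    SpinProd.jmul (lift z.x z.τ) (lift Δ.s Δ.κ) + SpinProd.jmul (lift z.s z.κ) (lift Δ.x Δ.τ)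
      = lift (mat z.x *ᵥ Δ.s + mat z.s *ᵥ Δ.x) (z.κ * Δ.τ + z.τ * Δ.κ) := by
  rw [jmul_lift, jmul_lift, add_comm (z.κ * Δ.τ), lift_add]

lemma transpose_mulVec_injective {A : Matrix (Fin p) (Idx d) ℝ} (hA : A.rank = p)
    {y : Fin p → ℝ} (h : Aᵀ *ᵥ y = 0) : y = 0 := by
  have hli : LinearIndependent ℝ A.row := by
    rw [linearIndependent_iff_card_eq_finrank_span, Set.finrank, ← Matrix.rank_eq_finrank_span_row, hA,
      Fintype.card_fin]
  rw [mulVec_transpose] at h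
  exact (Matrix.vecMul_injective_iff.2 hli) (by simpa using h)

theorem existsUnique_isDirection (P : Problem p d) (hA : P.A.rank = p) {γ : ℝ} (hγ0 : 0 ≤ γ)
    (hγ : γ < 1 / 3) {z : Point p d} (hz : z ∈ N2 p d γ) (ν : ℝ) :
    ∃! Δ : Point p d, IsDirection P ν 1 z Δ := by
  have hμ := mu_pos hz.1
  rw [mem_N2_iff hγ0] at hz
  have hinj : Function.Injective (directionMap P z) := by
    rw [← LinearMap.ker_eq_bot, LinearMap.ker_eq_bot']
    intro Δ hΔ
    simp only [directionMap, LinearMap.coe_mk, AddHom.coe_mk, Prod.mk_eq_zero] at hΔ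
    obtain ⟨h₁, h₂, h₃, h₄, h₅⟩ := hΔ
    have h0 := dotProduct_add_mul_eq_zero P h₁ h₂ h₃
    have hj := jmul_add_jmul_lift z Δ
    rw [h₄, h₅, show lift (0 : Vec d) 0 = 0 by simpa using lift_smul 0 (0 : Vec d) 0] at hj
    obtain ⟨hu, hv⟩ := SpinProd.eq_zero_of_jmul_add_jmul_eq_zero hz.1 hμ hγ0 hγ hz.2.2
      (by rw [inner_lift, h0]) hj
    obtain ⟨hx, hτ⟩ := lift_eq_zero hu
    obtain ⟨hs, hκ⟩ := lift_eq_zero hv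
    -- With Δs and Δτ zero, the dual row leaves AᵀΔy = 0; the full row rank of A enters here.
    have hy : Δ.y = 0 := by
      rw [hs, hτ] at h₂
      exact transpose_mulVec_injective hA (by simpa using h₂)
    exact Prod.ext hx (Prod.ext hy (Prod.ext hs (Prod.ext hκ hτ)))
  -- The system is square, so injectivity suffices for bijectivity.
  have hdim : Module.finrank ℝ (Point p d)
      = Module.finrank ℝ ((Fin p → ℝ) × Vec d × ℝ × Vec d × ℝ) := by
    simp only [Module.finrank_prod]
    ring
  have hbij : Function.Bijective (directionMap P z) :=
    ⟨hinj, (LinearMap.injective_iff_surjective_of_finrank_eq_finrank hdim).1 hinj⟩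
  simp only [isDirection_iff]
  exact hbij.existsUnique _

section direction

variable {P : Problem p d} {ν : ℝ} {z Δ : Point p d}

lemma rp_add_of_isDirection (h : IsDirection P ν 1 z Δ) : rp P (z + Δ) = ν • rp P z := by
  have h1 := h.1
  simp only [rp, Point.add_x, Point.add_τ, mulVec_add]
  linear_combination (norm := module) h1

lemma rd_add_of_isDirection (h : IsDirection P ν 1 z Δ) : rd P (z + Δ) = ν • rd P z := by
  have h1 := h.2.1
  simp only [rd, Point.add_y, Point.add_s, Point.add_τ, mulVec_add]
  linear_combination (norm := module) -h1

lemma jmul_add_jmul_eq_of_isDirection (h : IsDirection P ν 1 z Δ) :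
    SpinProd.jmul (lift z.x z.τ) (lift Δ.s Δ.κ) + SpinProd.jmul (lift z.s z.κ) (lift Δ.x Δ.τ)
      = (ν * mu z) • SpinProd.one - SpinProd.jmul (lift z.x z.τ) (lift z.s z.κ) := by
  simp only [isDirection_iff, directionMap, LinearMap.coe_mk, AddHom.coe_mk, Prod.mk.injEq] at h
  rw [jmul_add_jmul_lift, h.2.2.2.1, h.2.2.2.2, jmul_lift, ← lift_unit, ← lift_smul, ← lift_sub,
    mul_one, mul_comm z.κ]

/-- The complementarity equation paired with e, using ⟨e, x∘v⟩ = ⟨x, v⟩ and ‖e‖² = k + 1. -/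
lemma inner_add_inner_of_isDirection (h : IsDirection P ν 1 z Δ) :
    ⟪lift z.x z.τ, lift Δ.s Δ.κ⟫ + ⟪lift Δ.x Δ.τ, lift z.s z.κ⟫
      = -((1 - ν) * (mu z * ((k : ℝ) + 1))) := by
  have h1 := congrArg (fun v => ⟪(SpinProd.one : Ambient d), v⟫)
    (jmul_add_jmul_eq_of_isDirection h)
  simp only [inner_add_right, inner_sub_right, inner_one_jmul, inner_smul_right,
    real_inner_self_eq_norm_sq, norm_one_sq, inner_lift_eq_mu] at h1
  linarith [real_inner_comm (lift z.s z.κ) (lift Δ.x Δ.τ)]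

/-- Δ + (1 - ν)z solves the homogeneous linear rows, so skew-symmetry makes its two parts
orthogonal. Expanding, the mixed terms contribute -(1 - ν)²μ(k + 1) and cancel the term from z. -/
lemma inner_eq_zero_of_isDirection (h : IsDirection P ν 1 z Δ) :
    ⟪lift Δ.x Δ.τ, lift Δ.s Δ.κ⟫ = 0 := by
  have h0 := dotProduct_add_mul_eq_zero P (z := Δ + (1 - ν) • z) ?_ ?_ ?_
  · rw [← inner_lift] at h0
    simp only [Point.add_x, Point.add_s, Point.add_κ, Point.add_τ,
      Point.smul_x, Point.smul_s, Point.smul_κ, Point.smul_τ, lift_add,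
      lift_smul, inner_add_left, inner_add_right, inner_smul_left, inner_smul_right, conj_trivial,
      inner_lift_eq_mu z] at h0
    linear_combination h0 - (1 - ν) * inner_add_inner_of_isDirection h
  · have h1 := h.1
    simp only [Point.add_x, Point.add_τ, Point.smul_x, Point.smul_τ, mulVec_add, mulVec_smul]
    linear_combination (norm := module) h1
  · have h1 := h.2.1
    simp only [Point.add_y, Point.add_s, Point.add_τ,
      Point.smul_y, Point.smul_s, Point.smul_τ, mulVec_add, mulVec_smul]
    linear_combination (norm := module) h1
  · have h1 := h.2.2.1
    simp only [Point.add_x, Point.add_y, Point.add_κ, Point.smul_x, Point.smul_y, Point.smul_κ,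
      dotProduct_add, dotProduct_smul, smul_eq_mul]
    linear_combination h1

/-- The second-order term ⟨Δx, Δs⟩ vanishes, so μ changes exactly as its linearization does. -/
lemma mu_add_of_isDirection (h : IsDirection P ν 1 z Δ) : mu (z + Δ) = ν * mu z := by
  have h1 := inner_add_inner_of_isDirection h
  have h2 := inner_eq_zero_of_isDirection h
  have h3 := inner_lift_eq_mu z
  have h4 := inner_lift_eq_mu (z + Δ)
  simp only [Point.add_x, Point.add_s, Point.add_κ, Point.add_τ, lift_add, inner_add_left,
    inner_add_right] at h4
  have hk : (k : ℝ) + 1 ≠ 0 := by positivity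
  refine mul_right_cancel₀ hk ?_
  linarith

theorem add_mem_N2_of_isDirection {γ δ : ℝ} (hγ0 : 0 < γ) (hγ : γ < 1 / 3) (hν1 : ν ≤ 1)
    (hνδ : 2 * ((1 - ν) ^ 2 * ((k : ℝ) + 1)) = δ ^ 2)
    (hpar : 4 * (γ ^ 2 + δ ^ 2) / (1 - 3 * γ) ^ 2 ≤ γ * ν) (hz : z ∈ N2 p d γ)
    (h : IsDirection P ν 1 z Δ) : z + Δ ∈ N2 p d γ := by
  have hμ := mu_pos hz.1
  rw [mem_N2_iff hγ0.le] at hz ⊢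
  obtain ⟨hx, -, hp⟩ := hz
  rw [mu_add_of_isDirection h]
  simp only [Point.add_x, Point.add_s, Point.add_κ, Point.add_τ, lift_add]
  refine SpinProd.pos_and_norm_scale_sub_le (δ := δ) hx hμ hγ0 hγ
    (mul_le_of_le_one_left hμ.le hν1) hp ?_
    ((mul_le_mul_of_nonneg_right hpar hμ.le).trans_eq (mul_assoc _ _ _))
    (inner_eq_zero_of_isDirection h) (jmul_add_jmul_eq_of_isDirection h)
  -- The definition of μ makes p orthogonal to e, so ‖g‖² splits: the centrality part contributes γ²
  -- and the reduction of μ contributes δ².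
  have h0 : ⟪(SpinProd.one : Ambient d),
      SpinProd.scale (lift z.x z.τ) (lift z.s z.κ) - mu z • SpinProd.one⟫ = 0 := by
    rw [inner_sub_right, inner_one_scale, inner_smul_right, real_inner_self_eq_norm_sq, norm_one_sq,
      inner_lift_eq_mu, sub_self]
  rw [norm_sub_sq_real, inner_smul_left, h0, norm_smul, mul_pow, norm_one_sq, Real.norm_eq_abs,
    sq_abs]
  linear_combination hp + mu z ^ 2 * hνδ

end direction

end SOCP

/-! ### Induction over the iterations -/

theorem proposition4 {k p : ℕ} (d : Fin k → ℕ) (P : SOCP.Problem p d) (hA : P.A.rank = p)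
    (γ δ ε : ℝ) (hγ : γ ∈ Set.Ioo (0 : ℝ) (1 / 3)) (hδ : δ ∈ Set.Ioo (0 : ℝ) 1)
    (hε : ε ∈ Set.Ioo (0 : ℝ) 1)
    (hpar : 4 * (γ ^ 2 + δ ^ 2) / (1 - 3 * γ) ^ 2
      * (1 - δ / Real.sqrt (2 * ((k : ℝ) + 1)))⁻¹ < γ)
    (z₀ : SOCP.Point p d) (hz₀ : z₀ ∈ SOCP.N2 p d γ)
    (j : ℕ) (z : SOCP.Point p d) (hz : SOCP.Reaches P δ ε 1 z₀ j z) :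
    (∃! Δ : SOCP.Point p d, SOCP.IsDirection P (SOCP.nu k δ) 1 z Δ) ∧
    z ∈ SOCP.N2 p d γ ∧
    SOCP.norm2 (SOCP.rp P z)
      = (1 - δ / Real.sqrt (2 * ((k : ℝ) + 1))) ^ j * SOCP.norm2 (SOCP.rp P z₀) ∧
    SOCP.norm2 (SOCP.rd P z)
      = (1 - δ / Real.sqrt (2 * ((k : ℝ) + 1))) ^ j * SOCP.norm2 (SOCP.rd P z₀) ∧
    SOCP.mu z = (1 - δ / Real.sqrt (2 * ((k : ℝ) + 1))) ^ j * SOCP.mu z₀ := by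
  have hk : (0 : ℝ) ≤ k := k.cast_nonneg
  have hr : 1 ≤ √(2 * ((k : ℝ) + 1)) := Real.one_le_sqrt.2 (by linarith)
  have hr0 : 0 < √(2 * ((k : ℝ) + 1)) := by linarith
  have hν0 : 0 < SOCP.nu k δ := by
    rw [SOCP.nu, sub_pos, div_lt_one hr0]
    exact hδ.2.trans_le hr
  have hν1 : SOCP.nu k δ ≤ 1 := sub_le_self _ (div_nonneg hδ.1.le hr0.le)
  -- The normalization √(2(k + 1)) in ν is what makes √2‖(θ - μ)e‖ equal to δμ.
  have hνδ : 2 * ((1 - SOCP.nu k δ) ^ 2 * ((k : ℝ) + 1)) = δ ^ 2 := by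
    rw [SOCP.nu, sub_sub_cancel, div_pow, Real.sq_sqrt (by positivity)]
    field_simp
  rw [← SOCP.nu] at hpar ⊢
  have hpar' : 4 * (γ ^ 2 + δ ^ 2) / (1 - 3 * γ) ^ 2 ≤ γ * SOCP.nu k δ := by
    rw [← div_eq_mul_inv, div_lt_iff₀ hν0] at hpar
    exact hpar.le
  have key : z ∈ SOCP.N2 p d γ ∧
      SOCP.norm2 (SOCP.rp P z) = SOCP.nu k δ ^ j * SOCP.norm2 (SOCP.rp P z₀) ∧
      SOCP.norm2 (SOCP.rd P z) = SOCP.nu k δ ^ j * SOCP.norm2 (SOCP.rd P z₀) ∧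
      SOCP.mu z = SOCP.nu k δ ^ j * SOCP.mu z₀ := by
    induction hz with
    | init => simpa using hz₀
    | step _ _ hΔ ih =>
      obtain ⟨hN, hp, hd, hm⟩ := ih
      refine ⟨SOCP.add_mem_N2_of_isDirection hγ.1 hγ.2 hν1 hνδ hpar' hN hΔ, ?_, ?_, ?_⟩
      · rw [SOCP.rp_add_of_isDirection hΔ, SOCP.norm2_smul, abs_of_pos hν0, hp, pow_succ']
        ring
      · rw [SOCP.rd_add_of_isDirection hΔ, SOCP.norm2_smul, abs_of_pos hν0, hd, pow_succ']
        ring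
      · rw [SOCP.mu_add_of_isDirection hΔ, hm, pow_succ']
        ring
  exact ⟨SOCP.existsUnique_isDirection P hA hγ.1.le hγ.2 key.1 _, key⟩
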